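/- For an integer $n \ge 1$ and a subset $x$ of $\mathbb{Z}_n = \mathbb{Z}/n\mathbb{Z}$, let $\Delta(x) = \{a - b \mid a, b \in x,\ a \ne b\}$. A conflict-avoiding code of length $n$ and weight $w$ is a collection $\mathcal{C}$ of $w$-element subsets of $\mathbb{Z}_n$ such that $\Delta(x) \cap \Delta(y) = \varnothing$ for all distinct $x, y \in \mathcal{C}$; it is optimal if it has the maximal size $|\mathcal{C}|$ among all conflict-avoiding codes of length $n$ and weight $w$. Theorem. Let $p$ be an odd prime such that $4$ does not divide the multiplicative order of $2$ in $\mathbb{Z}_p^{\times}$, and let $\ell = [\mathbb{Z}_p^{\times} : \langle -1, 2\rangle]$ be the index of the subgroup generated by $-1$ and $2$. If $\ell$ is an odd prime, then an optimal conflict-avoiding code of length $p$ and weight $3$ exists, and every such code has size $$\frac{p - 1 - 2\ell}{4} + \left\lfloor \frac{\ell}{3} \right\rfloor.$$ -/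

import Mathlib

/-- The difference set `Δ(x) = {a - b | a, b ∈ x, a ≠ b}` of a finite subset `x` of `ℤ/nℤ`. -/
def differenceSet {n : ℕ} (x : Finset (ZMod n)) : Finset (ZMod n) :=
  x.offDiag.image (fun q => q.1 - q.2)

/-- A conflict-avoiding code of length `n` and weight `w`: a collection of `w`-element subsets of
`ℤ/nℤ` such that any two distinct members have disjoint difference sets. -/
def IsConflictAvoidingCode (n w : ℕ) (C : Finset (Finset (ZMod n))) : Prop :=
  (∀ x ∈ C, x.card = w) ∧
    ∀ x ∈ C, ∀ y ∈ C, x ≠ y → Disjoint (differenceSet x) (differenceSet y)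

/-- A conflict-avoiding code is optimal if it has the maximal size among all conflict-avoiding
codes of the same length and weight. -/
def IsOptimalConflictAvoidingCode (n w : ℕ) (C : Finset (Finset (ZMod n))) : Prop :=
  IsConflictAvoidingCode n w C ∧
    ∀ D : Finset (Finset (ZMod n)), IsConflictAvoidingCode n w D → D.card ≤ C.card

/-- The subgroup `⟨-1, 2⟩` of the unit group of `ℤ/pℤ`, generated by the units with
values `-1` and `2` (both are units when `p` is odd). -/
def negOneTwoSubgroup (p : ℕ) : Subgroup (ZMod p)ˣ :=
  Subgroup.closure {u : (ZMod p)ˣ | (u : ZMod p) = -1 ∨ (u : ZMod p) = 2}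

/-! Let `H = ⟨-1, 2⟩`. The order hypothesis gives `|H| = 2m` with `m = 2k + 1`, so `p - 1 = 2ml` and
the claimed size is `kl + ⌊l/3⌋`. Upper bound (`IsConflictAvoidingCode.card_le`): a word has at
least six differences, or is a progression with differences `±e, ±2e`, all in one coset of `H`; a
coset has `4k + 2` elements, so it hosts at most `k` progressions. Counting nonzero residues does
the rest. Lower bound (`exists_isConflictAvoidingCode_card`): packing `k` progressions into each
coset leaves one pair `±e` per coset. If `x + z = 1`, `xz ∈ H` and `x ∉ H`, then `x` generates the
quotient by `H`, and multiples of `{0, x, x ^ 2}` absorb the leftover pairs of three consecutive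
cosets. The crux is such an `x` (`exists_add_eq_one_mul_pow_eq_one`). Without one, the group `A` of
`m`-th roots of unity satisfies `1 + A ⊆ H` (`one_add_pow_eq_one_of_forall_add_eq_one`), which a
group ring computation refutes (`exists_one_add_pow_ne_one`). -/

/-! ### Group ring argument: `1 + A` is not contained in `H`. -/

open AddMonoidAlgebra in
/-- The element `∑ a ∈ A, [a]` of the integral group ring of `ZMod p`. -/
noncomputable def groupRingSum {p : ℕ} (A : Finset (ZMod p)) : AddMonoidAlgebra ℤ (ZMod p) :=
  ∑ a ∈ A, single a 1

theorem coeff_groupRingSum_mul {p : ℕ} (A : Finset (ZMod p)) (f : AddMonoidAlgebra ℤ (ZMod p))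
    (d : ZMod p) : (groupRingSum A * f).coeff d = ∑ a ∈ A, f.coeff (d - a) := by
  rw [groupRingSum, Finset.sum_mul, AddMonoidAlgebra.coeff_sum, Finsupp.finsetSum_apply]
  refine Finset.sum_congr rfl fun a _ => ?_
  rw [AddMonoidAlgebra.coeff_single_mul_apply, one_mul, neg_add_eq_sub]

theorem coeff_groupRingSum {p : ℕ} (A : Finset (ZMod p)) (d : ZMod p) :
    (groupRingSum A).coeff d = if d ∈ A then 1 else 0 := by
  rw [groupRingSum, AddMonoidAlgebra.coeff_sum, Finsupp.finsetSum_apply]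
  simp [Finsupp.single_apply]

theorem coeff_groupRingSum_mul_groupRingSum {p : ℕ} (A B : Finset (ZMod p)) (d : ZMod p) :
    (groupRingSum A * groupRingSum B).coeff d = ((A.filter (fun a => d - a ∈ B)).card : ℤ) := by
  rw [coeff_groupRingSum_mul]
  simp only [coeff_groupRingSum, Finset.sum_boole]

theorem groupRingSum_mul_univ {p : ℕ} [NeZero p] (A : Finset (ZMod p)) :
    groupRingSum A * groupRingSum Finset.univ = (A.card : ℤ) • groupRingSum Finset.univ := by
  ext d
  rw [coeff_groupRingSum_mul, AddMonoidAlgebra.coeff_smul_apply]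
  simp [coeff_groupRingSum]

/-- A function on `ZMod p` all of whose values are averages over translates by a fixed set
containing `1` is constant. -/
theorem eq_of_forall_sum_sub_eq {p : ℕ} [NeZero p] (H : Finset (ZMod p)) (h1 : 1 ∈ H)
    (f : ZMod p → ℤ) (hf : ∀ d, ∑ h ∈ H, f (d - h) = H.card * f d) (a b : ZMod p) : f a = f b := by
  -- Maximum principle: where the maximum is attained, every translate in the average attains it
  -- too; steps by `1` reach every residue.
  obtain ⟨d, hd⟩ := Finite.exists_max f
  have step : ∀ n : ℕ, f (d - n) = f d := by
    intro n
    induction n with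
    | zero => simp
    | succ n ih =>
      have h2 : ∑ h ∈ H, (f d - f (d - n - h)) = 0 := by
        rw [Finset.sum_sub_distrib, hf, ih]; simp
      have h3 := (Finset.sum_eq_zero_iff_of_nonneg
        (fun h _ => sub_nonneg.2 (hd (d - n - h)))).1 h2 1 h1
      push_cast
      rw [← sub_sub]
      linarith
  have all : ∀ x, f x = f d := by
    intro x
    have := step (d - x).val
    rwa [ZMod.natCast_zmod_val, sub_sub_cancel] at this
  rw [all a, all b]

/-- For odd `m` with `2m + 1 < p`, the translate by `1` of the group of `m`-th roots of unity in
`ZMod p` is not contained in the group of `2m`-th roots of unity. -/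
theorem exists_one_add_pow_ne_one {p : ℕ} [Fact p.Prime] {m : ℕ} (hm : Odd m)
    (hmp : 2 * m + 1 < p) : ∃ t : ZMod p, t ^ m = 1 ∧ (1 + t) ^ (2 * m) ≠ 1 := by
  by_contra! hcon
  have hm0 : m ≠ 0 := by rintro rfl; simp at hm
  have hneg1 : (-1 : ZMod p) ≠ 1 := by
    have : Fact (2 < p) := ⟨by omega⟩
    exact ZMod.neg_one_ne_one
  set A : Finset (ZMod p) := Finset.univ.filter (fun a => a ^ m = 1) with hA
  set B : Finset (ZMod p) := Finset.univ.filter (fun a => a ^ m = -1) with hB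
  have mA : ∀ a, a ∈ A ↔ a ^ m = 1 := by simp [hA]
  have mB : ∀ a, a ∈ B ↔ a ^ m = -1 := by simp [hB]
  have nA : ∀ a, -a ∈ A ↔ a ∈ B := by
    intro a; rw [mA, mB, hm.neg_pow, neg_eq_iff_eq_neg]
  have nB : ∀ a, -a ∈ B ↔ a ∈ A := by
    intro a; rw [mA, mB, hm.neg_pow, neg_inj]
  have one_mem : (1 : ZMod p) ∈ A := by simp [mA]
  have hAB : ∀ a ∈ A, a ∉ B := by
    intro a ha hb; rw [mA] at ha; rw [mB, ha] at hb; exact hneg1 hb.symm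
  have zA : (0 : ZMod p) ∉ A := by simp [mA, hm0]
  have zB : (0 : ZMod p) ∉ B := by simp [mB, hm0]
  have hH : ∀ a, a ^ (2 * m) = 1 → a ∈ A ∨ a ∈ B := by
    intro a ha
    rw [mul_comm, pow_mul, sq_eq_one_iff] at ha
    rw [mA, mB]; exact ha
  have mulA : ∀ a ∈ A, ∀ b, a * b ∈ A ↔ b ∈ A := by
    intro a ha b; rw [mA] at ha; rw [mA, mA, mul_pow, ha, one_mul]
  -- `r d` counts representations of `d` as a sum of two elements of `A`. It is invariant under
  -- multiplication by `A`, hence constant on `A` and on `B = -A`.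
  set r : ZMod p → ℕ := fun d => (A.filter (fun a => d - a ∈ A)).card with hr
  have r_mul : ∀ c ∈ A, ∀ d, r (c * d) = r d := by
    intro c hc d
    have hc0 : c ≠ 0 := by rintro rfl; exact zA hc
    have : A.filter (fun a => c * d - a ∈ A) = (A.filter (fun a => d - a ∈ A)).image (c * ·) := by
      ext a
      simp only [Finset.mem_filter, Finset.mem_image]
      constructor
      · rintro ⟨ha, hb⟩
        refine ⟨c⁻¹ * a, ⟨?_, ?_⟩, by field_simp⟩
        · rw [← mulA c hc]; convert ha using 1; field_simp
        · rw [← mulA c hc]; convert hb using 1; field_simp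
      · rintro ⟨b, ⟨hb, hdb⟩, rfl⟩
        exact ⟨(mulA c hc _).2 hb, by rw [← mul_sub]; exact (mulA c hc _).2 hdb⟩
    simp only [hr]
    rw [this, Finset.card_image_of_injective _ (mul_right_injective₀ hc0)]
  -- A sum `a + a'` equals `a(1 + a'/a)`, which `hcon` places in `A ∪ B`.
  have r_zero : ∀ d, d ∉ A → d ∉ B → r d = 0 := by
    intro d hdA hdB
    simp only [hr, Finset.card_eq_zero, Finset.filter_eq_empty_iff]
    intro a ha hda
    have ha0 : a ≠ 0 := by rintro rfl; exact zA ha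
    have ha' := (mA a).1 ha
    have h1 : (1 + (d - a) / a) ^ (2 * m) = 1 := by
      apply hcon
      rw [div_pow, (mA _).1 hda, ha', div_one]
    have h2 : 1 + (d - a) / a = d / a := by field_simp; ring
    rw [h2, div_pow, mul_comm 2 m, pow_mul a, ha', one_pow, div_one, mul_comm m 2] at h1
    rcases hH d h1 with h | h
    · exact hdA h
    · exact hdB h
  have r_A : ∀ d ∈ A, r d = r 1 := fun d hd => by simpa using r_mul d hd 1
  have r_B : ∀ d ∈ B, r d = r (-1) := fun d hd => by
    simpa using r_mul (-d) ((nA d).2 hd) (-1)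
  have r_neg : ∀ d, (B.filter (fun b => d - b ∈ B)).card = r (-d) := by
    intro d
    have : B.filter (fun b => d - b ∈ B) = (A.filter (fun a => -d - a ∈ A)).image (-·) := by
      ext b
      simp only [Finset.mem_filter, Finset.mem_image]
      constructor
      · rintro ⟨hb, hdb⟩
        exact ⟨-b, ⟨(nA b).2 hb, by rw [← nA] at hdb; convert hdb using 1; ring⟩, neg_neg b⟩
      · rintro ⟨a, ⟨ha, hda⟩, rfl⟩
        exact ⟨(nB a).2 ha, by rw [← nA]; convert hda using 1; ring⟩
    rw [this, Finset.card_image_of_injective _ neg_injective]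
  have cardB : B.card = A.card := by
    have : B = A.image (-·) := by
      ext b
      simp only [Finset.mem_image]
      exact ⟨fun hb => ⟨-b, (nA b).2 hb, neg_neg b⟩, by rintro ⟨a, ha, rfl⟩; exact (nB a).2 ha⟩
    rw [this, Finset.card_image_of_injective _ neg_injective]
  set a := groupRingSum A with ha_def
  set b := groupRingSum B with hb_def
  set J := groupRingSum (Finset.univ : Finset (ZMod p)) with hJ_def
  set Q : ℤ := (r 1 : ℤ) with hQ
  set P : ℤ := (r (-1) : ℤ) with hP
  set M : ℤ := (A.card : ℤ) with hM
  have haa : a * a = Q • a + P • b := by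
    ext d
    rw [ha_def, coeff_groupRingSum_mul_groupRingSum, AddMonoidAlgebra.coeff_add,
      Finsupp.add_apply, AddMonoidAlgebra.coeff_smul_apply, AddMonoidAlgebra.coeff_smul_apply,
      hb_def, coeff_groupRingSum, coeff_groupRingSum]
    change (r d : ℤ) = _
    by_cases hdA : d ∈ A
    · simp [hdA, hAB d hdA, r_A d hdA, hQ]
    · by_cases hdB : d ∈ B
      · simp [hdA, hdB, r_B d hdB, hP]
      · simp [hdA, hdB, r_zero d hdA hdB]
  have hbb : b * b = Q • b + P • a := by
    ext d
    rw [hb_def, coeff_groupRingSum_mul_groupRingSum, AddMonoidAlgebra.coeff_add,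
      Finsupp.add_apply, AddMonoidAlgebra.coeff_smul_apply, AddMonoidAlgebra.coeff_smul_apply,
      ha_def, coeff_groupRingSum, coeff_groupRingSum, r_neg]
    by_cases hdA : d ∈ A
    · have : -d ∈ B := (nB d).2 hdA
      simp [hdA, hAB d hdA, r_B _ this, hP]
    · by_cases hdB : d ∈ B
      · have : -d ∈ A := (nA d).2 hdB
        simp [hdA, hdB, r_A _ this, hQ]
      · simp [hdA, hdB, r_zero (-d) (by rwa [nA]) (by rwa [nB])]
  have haJ : a * J = M • J := groupRingSum_mul_univ A
  have hbJ : b * J = M • J := by rw [hM, ← cardB]; exact groupRingSum_mul_univ B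
  have hMpos : 0 < M := by
    rw [hM]; exact_mod_cast Finset.card_pos.2 ⟨1, one_mem⟩
  -- Multiplication by `J` records total mass; compare both sides of `haa`.
  have hMQP : M = Q + P := by
    have h1 : (M * M) • J = ((Q + P) * M) • J := by
      calc (M * M) • J = a * (a * J) := by rw [haJ, mul_smul_comm, haJ, smul_smul]
        _ = a * a * J := (mul_assoc _ _ _).symm
        _ = ((Q + P) * M) • J := by
          rw [haa, add_mul, smul_mul_assoc, smul_mul_assoc, haJ, hbJ, ← add_smul, smul_smul]
    have h2 := congrArg (fun x => x.coeff 0) h1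
    simp only [AddMonoidAlgebra.coeff_smul_apply, hJ_def, coeff_groupRingSum, Finset.mem_univ,
      if_true, smul_eq_mul, mul_one] at h2
    exact mul_right_cancel₀ hMpos.ne' h2
  -- `E` is chosen to be an eigenvector of `a + b` with eigenvalue `|A ∪ B|`, so its coefficients
  -- are constant; they vanish because the one at `0` does.
  set E := a * b + P • (a + b) - M • J with hE
  have hEeig : (a + b) * E = (2 * M) • E := by
    rw [hE]
    simp only [zsmul_eq_mul] at haa hbb haJ hbJ ⊢
    have hMQP' : (M : AddMonoidAlgebra ℤ (ZMod p)) = Q + P := by rw [hMQP]; push_cast; rfl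
    push_cast
    linear_combination (b + 2 * P) * haa + (a + 2 * P) * hbb - M * haJ - M * hbJ
      - 2 * (P * (a + b) + a * b) * hMQP'
  have coeffE : ∀ d, E.coeff d = ((A.filter (fun x => d - x ∈ B)).card : ℤ)
      + P * ((if d ∈ A then 1 else 0) + (if d ∈ B then 1 else 0)) - M := by
    intro d
    rw [hE, AddMonoidAlgebra.coeff_sub, Finsupp.sub_apply, AddMonoidAlgebra.coeff_add,
      Finsupp.add_apply, AddMonoidAlgebra.coeff_smul_apply, AddMonoidAlgebra.coeff_smul_apply,
      AddMonoidAlgebra.coeff_add, Finsupp.add_apply, ha_def, hb_def, hJ_def,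
      coeff_groupRingSum_mul_groupRingSum, coeff_groupRingSum, coeff_groupRingSum,
      coeff_groupRingSum]
    simp
  have hdisj : Disjoint A B := Finset.disjoint_left.2 hAB
  have hconst := eq_of_forall_sum_sub_eq (A ∪ B) (Finset.mem_union_left _ one_mem) E.coeff (by
    intro d
    have h1 := congrArg (fun x => x.coeff d) hEeig
    simp only [AddMonoidAlgebra.coeff_smul_apply, add_mul, AddMonoidAlgebra.coeff_add,
      Finsupp.add_apply, smul_eq_mul] at h1
    rw [ha_def, hb_def, coeff_groupRingSum_mul, coeff_groupRingSum_mul] at h1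
    rw [Finset.sum_union hdisj, h1, Finset.card_union_of_disjoint hdisj, cardB]
    push_cast; rw [hM]; ring)
  have hE0 : E.coeff 0 = 0 := by
    rw [coeffE, if_neg zA, if_neg zB]
    have : A.filter (fun x => 0 - x ∈ B) = A := by
      rw [Finset.filter_true_of_mem]
      intro x hx; rw [zero_sub]; exact (nB x).2 hx
    rw [this]; simp [hM]
  obtain ⟨u, hu⟩ : ∃ u : (ZMod p)ˣ, u ^ (2 * m) ≠ 1 := by
    by_contra! h
    have h1 := (FiniteField.forall_pow_eq_one_iff (ZMod p) (2 * m)).1 h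
    rw [ZMod.card] at h1
    have := Nat.le_of_dvd (by omega) h1
    omega
  set d : ZMod p := (u : ZMod p) with hd
  have hd0 : d ≠ 0 := u.ne_zero
  have hdH : d ^ (2 * m) ≠ 1 := by
    intro h; apply hu; ext; rw [Units.val_pow_eq_pow_val, ← hd, h, Units.val_one]
  have hdA : d ∉ A := by
    intro h; apply hdH; rw [mul_comm, pow_mul, (mA d).1 h, one_pow]
  have hdB : d ∉ B := by
    intro h; apply hdH; rw [mul_comm, pow_mul, (mB d).1 h]; norm_num
  have hEd := coeffE d
  rw [hconst d 0, hE0, if_neg hdA, if_neg hdB, hM] at hEd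
  have hcard : (A.filter (fun x => d - x ∈ B)).card = A.card := by
    have : ((A.filter (fun x => d - x ∈ B)).card : ℤ) = A.card := by linarith
    exact_mod_cast this
  have hall := Finset.filter_card_eq hcard
  -- Vanishing of `E` at `d` gives `d - A ⊆ B`, so `A` is stable under subtracting `d`. Repeated
  -- subtraction from `1` reaches `0`.
  have hshift : ∀ n : ℕ, 1 - n * d ∈ A := by
    intro n
    induction n with
    | zero => simpa using one_mem
    | succ n ih =>
      have := hall _ ih
      rw [← nA] at this
      convert this using 1
      push_cast; ring
  apply zA
  have := hshift (d⁻¹).val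
  rwa [ZMod.natCast_zmod_val, inv_mul_cancel₀ hd0, sub_self] at this

/-! ### Existence of the solution of `x + z = 1`. -/

/-- If `x + z = 1` and `xz` is a `2m`-th root of unity force `x` to be one, then `1 + t` is a
`2m`-th root of unity for every `m`-th root of unity `t`. -/
theorem one_add_pow_eq_one_of_forall_add_eq_one {p : ℕ} [Fact p.Prime] {m l : ℕ} (hm : Odd m)
    (hl : Odd l) (hp : p = 2 * m * l + 1) (h2 : (2 : ZMod p) ^ (2 * m) = 1)
    (H : ∀ x z : ZMod p, x + z = 1 → (x * z) ^ (2 * m) = 1 → x ^ (2 * m) = 1)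
    (t : ZMod p) (ht : t ^ m = 1) : (1 + t) ^ (2 * m) = 1 := by
  have hm0 : m ≠ 0 := by rintro rfl; simp at hm
  have hl0 : l ≠ 0 := by rintro rfl; simp at hl
  have hp2 : 2 < p := by
    have := Nat.mul_pos (Nat.pos_of_ne_zero hm0) (Nat.pos_of_ne_zero hl0)
    rw [hp, mul_assoc]; omega
  have h20 : (2 : ZMod p) ≠ 0 := by
    intro h; rw [h, zero_pow (by omega)] at h2; exact zero_ne_one h2
  have h4 : (4 : ZMod p) ^ m = 1 := by
    rw [← h2, pow_mul]; norm_num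
  have hhalf : p / 2 = m * l := by rw [hp, mul_assoc]; omega
  have ne_zero_of {g : ZMod p} (hg : g ^ m = 1) : g ≠ 0 := by
    rintro rfl; rw [zero_pow hm0] at hg; exact zero_ne_one hg
  have one_add_ne {g : ZMod p} (hg : g ^ m = 1) : 1 + g ≠ 0 := by
    intro h
    have : g = -1 := by linear_combination h
    rw [this, hm.neg_one_pow] at hg
    have : Fact (2 < p) := ⟨hp2⟩
    exact ZMod.neg_one_ne_one hg
  have inv_pow' {g : ZMod p} (hg : g ^ m = 1) : g⁻¹ ^ m = 1 := by rw [inv_pow, hg, inv_one]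
  have eq_one_of_sq {g : ZMod p} (hg : g ^ m = 1) (hsq : g ^ 2 = 1) : g = 1 := by
    obtain ⟨k, rfl⟩ := hm
    rwa [pow_succ, pow_mul, hsq, one_pow, one_mul] at hg
  -- Since `(p - 1)/2 = ml` is odd, `-1` is a nonresidue, while `g` is a residue; and `1 - g⁻¹ = -(1
  -- - g)g⁻¹`.
  have square_or (g : ZMod p) (hg : g ^ m = 1) : IsSquare (1 - g) ∨ IsSquare (1 - g⁻¹) := by
    have hg0 := ne_zero_of hg
    by_cases h1 : g = 1
    · left; rw [h1, sub_self]; exact ⟨0, by simp⟩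
    have hg1 : 1 - g ≠ 0 := fun h => h1 (by linear_combination -h)
    have hgi : 1 - g⁻¹ = -((1 - g) * g⁻¹) := by field_simp; ring
    have hgi0 : 1 - g⁻¹ ≠ 0 := by
      rw [hgi]; exact neg_ne_zero.2 (mul_ne_zero hg1 (inv_ne_zero hg0))
    rw [ZMod.euler_criterion p hg1, ZMod.euler_criterion p hgi0]
    rcases ZMod.pow_div_two_eq_neg_one_or_one p hg1 with h | h
    · exact Or.inl h
    · right
      rw [hgi, hhalf, (hm.mul hl).neg_pow, mul_pow, ← hhalf, h, hhalf, pow_mul, inv_pow' hg,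
        one_pow, mul_one, neg_neg]
  -- With `1 - g = s²`, take `x, z = (1 ± s)/2`, so that `x + z = 1` and `4xz = g`. Then `H`
  -- applies, and `t = z/x` has `1 + t = x⁻¹`.
  have key (g : ZMod p) (hg : g ^ m = 1) (hs : IsSquare (1 - g)) :
      ∃ t : ZMod p, t ^ m = 1 ∧ (1 + t) ^ (2 * m) = 1 ∧ 4 * t = g * (1 + t) ^ 2 := by
    obtain ⟨s, hs⟩ := hs
    have hg0 := ne_zero_of hg
    have hg' : g = 1 - s * s := by linear_combination -hs
    set x := (1 + s) / 2 with hx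
    set z := (1 - s) / 2 with hz
    have hxz : x + z = 1 := by rw [hx, hz]; field_simp; ring
    have hmul : 4 * (x * z) = g := by
      have h2x : 2 * x = 1 + s := by rw [hx]; field_simp
      have h2z : 2 * z = 1 - s := by rw [hz]; field_simp
      linear_combination (2 * z) * h2x + (1 + s) * h2z - hg'
    have hmulm : (x * z) ^ m = 1 := by
      have : (4 * (x * z)) ^ m = 1 := by rw [hmul, hg]
      rwa [mul_pow, h4, one_mul] at this
    have hx1 := H x z hxz (by rw [mul_comm 2 m, pow_mul, hmulm, one_pow])
    have hx0 : x ≠ 0 := by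
      intro h; rw [h, zero_mul, zero_pow hm0] at hmulm; exact zero_ne_one hmulm
    have h1t : 1 + z / x = x⁻¹ := by field_simp; exact hxz
    refine ⟨z / x, ?_, ?_, ?_⟩
    · have : z / x = (x * z) / x ^ 2 := by field_simp
      rw [this, div_pow, hmulm, ← pow_mul, hx1, div_one]
    · rw [h1t, inv_pow, hx1, inv_one]
    · rw [h1t, ← hmul]; field_simp
  choose! τ hτ1 hτ2 hτ3 using key
  classical
  -- The value of `σ` at `g` determines `g` up to inversion. Inverting the output in the second case
  -- is what rules out a collision between the two cases.
  let σ : {g : ZMod p // g ^ m = 1} → {g : ZMod p // g ^ m = 1} := fun g =>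
    if hs : IsSquare (1 - g.1) then ⟨τ g.1, hτ1 g.1 g.2 hs⟩
    else ⟨(τ g.1⁻¹)⁻¹, inv_pow' (hτ1 _ (inv_pow' g.2) ((square_or g.1 g.2).resolve_left hs))⟩
  have hσ1 (g) (hs : IsSquare (1 - g.1)) : 4 * (σ g).1 = g.1 * (1 + (σ g).1) ^ 2 := by
    simp only [σ, dif_pos hs]; exact hτ3 _ g.2 hs
  have hσ2 (g) (hs : ¬ IsSquare (1 - g.1)) : 4 * (σ g).1 = g.1⁻¹ * (1 + (σ g).1) ^ 2 := by
    have hs' := (square_or g.1 g.2).resolve_left hs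
    simp only [σ, dif_neg hs]
    have h := hτ3 _ (inv_pow' g.2) hs'
    have h0 := ne_zero_of (hτ1 _ (inv_pow' g.2) hs')
    have hg0 := ne_zero_of g.2
    generalize τ g.1⁻¹ = u at h h0 ⊢
    field_simp at h ⊢
    linear_combination h
  have hσ3 (g) : (1 + (σ g).1) ^ (2 * m) = 1 := by
    by_cases hs : IsSquare (1 - g.1)
    · simp only [σ, dif_pos hs]; exact hτ2 _ g.2 hs
    · have hs' := (square_or g.1 g.2).resolve_left hs
      simp only [σ, dif_neg hs]
      have h1 := hτ1 _ (inv_pow' g.2) hs'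
      have h0 := ne_zero_of h1
      have h := hτ2 _ (inv_pow' g.2) hs'
      have : 1 + (τ g.1⁻¹)⁻¹ = (1 + τ g.1⁻¹) / τ g.1⁻¹ := by
        rw [add_div, div_self h0, one_div, add_comm]
      rw [this, div_pow, h, mul_comm 2 m, pow_mul, h1, one_pow, div_one]
  have mixed (g g') (hs : IsSquare (1 - g.1)) (hs' : ¬ IsSquare (1 - g'.1)) : σ g ≠ σ g' := by
    intro h
    have e1 := hσ1 g hs
    have e2 := hσ2 g' hs'
    rw [← h] at e2
    have hn := pow_ne_zero 2 (one_add_ne (σ g).2)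
    have hgg : g.1 = g'.1⁻¹ := mul_right_cancel₀ hn (e1.symm.trans e2)
    have e3 : (σ g').1 = (σ g).1⁻¹ := by
      simp only [σ, dif_pos hs, dif_neg hs', hgg]
    rw [← h] at e3
    have h0 := ne_zero_of (σ g).2
    have hsq : (σ g).1 ^ 2 = 1 := by
      rw [sq]; nth_rewrite 2 [e3]; exact mul_inv_cancel₀ h0
    have hone : (σ g).1 = 1 := eq_one_of_sq (σ g).2 hsq
    rw [hone] at e1
    have hg1 : g.1 = 1 := by
      have h40 : (4 : ZMod p) ≠ 0 := ne_zero_of h4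
      apply mul_left_cancel₀ h40
      linear_combination -e1
    have hg1' : g'.1 = 1 := by rw [← inv_inv g'.1, ← hgg, hg1, inv_one]
    apply hs'
    rw [hg1', sub_self]; exact ⟨0, by simp⟩
  have hinj : Function.Injective σ := by
    intro g g' h
    have hn := pow_ne_zero 2 (one_add_ne (σ g).2)
    by_cases hs : IsSquare (1 - g.1) <;> by_cases hs' : IsSquare (1 - g'.1)
    · have e1 := hσ1 g hs
      have e2 := hσ1 g' hs'
      rw [← h] at e2
      exact Subtype.ext (mul_right_cancel₀ hn (e1.symm.trans e2))
    · exact absurd h (mixed g g' hs hs')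
    · exact absurd h.symm (mixed g' g hs' hs)
    · have e1 := hσ2 g hs
      have e2 := hσ2 g' hs'
      rw [← h] at e2
      exact Subtype.ext (inv_injective (mul_right_cancel₀ hn (e1.symm.trans e2)))
  -- By finiteness every `t` is a value of `σ`, and `hσ3` holds at all values.
  obtain ⟨g, hg⟩ := Finite.surjective_of_injective hinj ⟨t, ht⟩
  have := hσ3 g
  rwa [hg] at this

/-- The equation `x + z = 1` has a solution with `x z` a `2m`-th root of unity but `x` not: the
cosets of `x`, `1`, `z` modulo the `2m`-th roots of unity form a nonconstant progression. -/
theorem exists_add_eq_one_mul_pow_eq_one {p : ℕ} [Fact p.Prime] {m l : ℕ} (hm : Odd m)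
    (hl : Odd l) (hl1 : 1 < l) (hp : p = 2 * m * l + 1) (h2 : (2 : ZMod p) ^ (2 * m) = 1) :
    ∃ x z : ZMod p, x + z = 1 ∧ (x * z) ^ (2 * m) = 1 ∧ x ^ (2 * m) ≠ 1 := by
  by_contra! H
  have hlt : 2 * m + 1 < p := by
    have := hm.pos
    rw [hp]; nlinarith
  obtain ⟨t, ht, ht'⟩ := exists_one_add_pow_ne_one hm hlt
  exact ht' (one_add_pow_eq_one_of_forall_add_eq_one hm hl hp h2 H t ht)

/-! ### The order of `⟨-1, 2⟩`. -/

theorem closure_pow_eq_one {G : Type*} [CommGroup G] {S : Set G} {n : ℕ}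
    (h : ∀ s ∈ S, s ^ n = 1) {g : G} (hg : g ∈ Subgroup.closure S) : g ^ n = 1 := by
  induction hg using Subgroup.closure_induction with
  | mem x hx => exact h x hx
  | one => exact one_pow n
  | mul x y _ _ hx hy => rw [mul_pow, hx, hy, one_mul]
  | inv x _ hx => rw [inv_pow, hx, inv_one]

/-- If `4` does not divide the order of `2`, then `⟨-1, 2⟩` has order `2m` with `m` odd, and `m` is
the order of `2` modulo `±1`. -/
theorem exists_odd_half_card_negOneTwoSubgroup {p : ℕ} [Fact p.Prime] (hp_odd : Odd p)
    (h_order : ¬ 4 ∣ orderOf (2 : ZMod p)) :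
    ∃ m : ℕ, Odd m ∧ p = 2 * m * (negOneTwoSubgroup p).index + 1 ∧ (2 : ZMod p) ^ (2 * m) = 1 ∧
      ∀ n : ℕ, (2 : ZMod p) ^ (2 * n) = 1 → m ∣ n := by
  have hp2 : 2 < p := lt_of_le_of_ne (Fact.out : p.Prime).two_le (by
    rintro rfl; exact absurd hp_odd (by decide))
  have : Fact (2 < p) := ⟨hp2⟩
  have h20 : (2 : ZMod p) ≠ 0 := by
    intro h
    have h' : ((2 : ℕ) : ZMod p) = 0 := by exact_mod_cast h
    rw [ZMod.natCast_eq_zero_iff] at h'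
    exact absurd (Nat.le_of_dvd (by norm_num) h') (by omega)
  set o := orderOf (2 : ZMod p) with ho
  set H := negOneTwoSubgroup p with hH
  let u : (ZMod p)ˣ := Units.mk0 2 h20
  have hu : orderOf u = o := by rw [ho, ← orderOf_units]; rfl
  have huH : u ∈ H := Subgroup.subset_closure (Or.inr rfl)
  have hnH : (-1 : (ZMod p)ˣ) ∈ H := Subgroup.subset_closure (Or.inl rfl)
  have hn1 : orderOf (-1 : (ZMod p)ˣ) = 2 := by
    apply orderOf_eq_prime
    · simp
    · intro h
      exact ZMod.neg_one_ne_one (n := p) (congrArg Units.val h)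
  have hdvd : Nat.lcm 2 o ∣ Nat.card H := by
    apply Nat.lcm_dvd
    · have := orderOf_dvd_natCard (⟨-1, hnH⟩ : H)
      rwa [← Subgroup.orderOf_coe, hn1] at this
    · have := orderOf_dvd_natCard (⟨u, huH⟩ : H)
      rwa [← Subgroup.orderOf_coe, hu] at this
  -- `H` is cyclic, so its order is its exponent, which can be bounded on the generators.
  have hdvd' : Nat.card H ∣ Nat.lcm 2 o := by
    rw [← IsCyclic.exponent_eq_card, Monoid.exponent_dvd_iff_forall_pow_eq_one]
    rintro ⟨g, hg⟩
    ext1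
    push_cast
    refine closure_pow_eq_one ?_ hg
    rintro s (hs | hs)
    · have : s = -1 := Units.ext (by simpa using hs)
      rw [this, ← orderOf_dvd_iff_pow_eq_one, hn1]; exact Nat.dvd_lcm_left 2 o
    · have : s = u := Units.ext hs
      rw [this, ← orderOf_dvd_iff_pow_eq_one, hu]; exact Nat.dvd_lcm_right 2 o
  have hcard : Nat.card H = Nat.lcm 2 o := Nat.dvd_antisymm hdvd' hdvd
  obtain ⟨m, hm⟩ := Nat.dvd_lcm_left 2 o
  have hmul := H.card_mul_index
  rw [Nat.card_eq_fintype_card (α := (ZMod p)ˣ), ZMod.card_units, hcard, hm] at hmul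
  refine ⟨m, ?_, by omega, ?_, ?_⟩
  · rw [← Nat.not_even_iff_odd]
    rintro ⟨k, hk⟩
    apply h_order
    by_cases he : 2 ∣ o
    · rw [Nat.lcm_eq_right he] at hm
      exact ⟨k, by omega⟩
    · have hcop : Nat.Coprime 2 o := (Nat.prime_two.coprime_iff_not_dvd).2 he
      rw [hcop.lcm_eq_mul] at hm
      exact absurd ⟨k, by omega⟩ he
  · rw [← orderOf_dvd_iff_pow_eq_one, ← hm]; exact Nat.dvd_lcm_right 2 o
  · intro n hn
    rw [← orderOf_dvd_iff_pow_eq_one] at hn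
    have := Nat.lcm_dvd (Dvd.intro n rfl) hn
    rw [hm] at this
    exact Nat.dvd_of_mul_dvd_mul_left two_pos this

/-! ### Difference sets of triples. -/

theorem mem_differenceSet {n : ℕ} {x : Finset (ZMod n)} {d : ZMod n} :
    d ∈ differenceSet x ↔ ∃ a ∈ x, ∃ b ∈ x, a ≠ b ∧ a - b = d := by
  simp only [differenceSet, Finset.mem_image, Finset.mem_offDiag, Prod.exists]
  constructor
  · rintro ⟨a, b, ⟨ha, hb, hab⟩, rfl⟩; exact ⟨a, ha, b, hb, hab, rfl⟩
  · rintro ⟨a, ha, b, hb, hab, rfl⟩; exact ⟨a, b, ⟨ha, hb, hab⟩, rfl⟩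

theorem differenceSet_triple {n : ℕ} {u v w : ZMod n} (huv : u ≠ v) (huw : u ≠ w) (hvw : v ≠ w) :
    differenceSet {u, v, w} =
      {u - v, v - w, u - w, -(u - v), -(v - w), -(u - w)} := by
  ext d
  simp only [mem_differenceSet, Finset.mem_insert, Finset.mem_singleton, exists_eq_or_imp,
    exists_eq_left, neg_sub]
  simp only [ne_eq, not_true_eq_false, false_and, false_or, or_false, huv, huw, hvw, huv.symm,
    huw.symm, hvw.symm, not_false_eq_true, true_and]
  grind

theorem card_neg_two_mul {p : ℕ} [Fact p.Prime] (hp : 3 < p) {e : ZMod p} (he : e ≠ 0) :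
    ({e, -e, 2 * e, -(2 * e)} : Finset (ZMod p)).card = 4 := by
  have hk (k : ℕ) (hk0 : 0 < k) (hkp : k < p) : (k : ZMod p) * e ≠ 0 := by
    refine mul_ne_zero (fun h => ?_) he
    rw [ZMod.natCast_eq_zero_iff] at h
    exact absurd (Nat.le_of_dvd hk0 h) (by omega)
  have h2 : 2 * e ≠ 0 := by exact_mod_cast hk 2 (by omega) (by omega)
  have h3 : 3 * e ≠ 0 := by exact_mod_cast hk 3 (by omega) (by omega)
  have h4 : 4 * e ≠ 0 := by
    intro h
    have : (2 : ZMod p) * (2 * e) = 0 := by linear_combination h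
    rcases mul_eq_zero.1 this with h' | h'
    · exact h2 (by rw [h', zero_mul])
    · exact h2 h'
  have h12 : e ≠ -e := fun h => h2 (by linear_combination h)
  have h13 : e ≠ 2 * e := fun h => he (by linear_combination -h)
  have h14 : e ≠ -(2 * e) := fun h => h3 (by linear_combination h)
  have h23 : -e ≠ 2 * e := fun h => h3 (by linear_combination -h)
  have h24 : -e ≠ -(2 * e) := fun h => he (by linear_combination h)
  have h34 : 2 * e ≠ -(2 * e) := fun h => h4 (by linear_combination h)
  rw [Finset.card_insert_of_notMem, Finset.card_insert_of_notMem, Finset.card_insert_of_notMem,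
    Finset.card_singleton]
  · simpa using h34
  · simp only [Finset.mem_insert, Finset.mem_singleton, not_or]; exact ⟨h23, h24⟩
  · simp only [Finset.mem_insert, Finset.mem_singleton, not_or]; exact ⟨h12, h13, h14⟩

/-- A three-element subset of `ZMod p` has at least six differences unless it is an arithmetic
progression. -/
theorem six_le_card_differenceSet_or {p : ℕ} [Fact p.Prime] (hp : 3 < p) {x : Finset (ZMod p)}
    (hx : x.card = 3) :
    6 ≤ (differenceSet x).card ∨
      ∃ e : ZMod p, e ≠ 0 ∧ differenceSet x = {e, -e, 2 * e, -(2 * e)} := by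
  obtain ⟨u, v, w, huv, huw, hvw, rfl⟩ := Finset.card_eq_three.1 hx
  rw [differenceSet_triple huv huw hvw]
  have ha : u - v ≠ 0 := sub_ne_zero.2 huv
  have hb : v - w ≠ 0 := sub_ne_zero.2 hvw
  have hc : u - w ≠ 0 := sub_ne_zero.2 huw
  have habc : u - w = (u - v) + (v - w) := by ring
  generalize u - w = c at *
  generalize u - v = a at *
  generalize v - w = b at *
  subst habc
  have h20 : (2 : ZMod p) ≠ 0 := by
    intro h
    have h' : ((2 : ℕ) : ZMod p) = 0 := by exact_mod_cast h
    rw [ZMod.natCast_eq_zero_iff] at h'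
    exact absurd (Nat.le_of_dvd (by norm_num) h') (by omega)
  -- The three cases are those where `v`, `u` or `w` is the midpoint of the other two.
  by_cases h1 : a = b
  · right
    refine ⟨a, ha, ?_⟩
    subst h1
    ext d
    simp only [Finset.mem_insert, Finset.mem_singleton, ← two_mul]
    tauto
  by_cases h2 : b = -(2 * a)
  · right
    refine ⟨a, ha, ?_⟩
    subst h2
    have : a + -(2 * a) = -a := by ring
    ext d
    simp only [Finset.mem_insert, Finset.mem_singleton, this, neg_neg]
    tauto
  by_cases h3 : a = -(2 * b)
  · right
    refine ⟨b, hb, ?_⟩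
    subst h3
    have : -(2 * b) + b = -b := by ring
    ext d
    simp only [Finset.mem_insert, Finset.mem_singleton, this, neg_neg]
    tauto
  left
  have dbl {y : ZMod p} (hy : y ≠ 0) : y ≠ -y := fun h =>
    mul_ne_zero h20 hy (by linear_combination h)
  have n13 : a ≠ a + b := fun h => hb (by linear_combination -h)
  have n15 : a ≠ -b := fun h => hc (by linear_combination h)
  have n16 : a ≠ -(a + b) := fun h => h2 (by linear_combination h)
  have n23 : b ≠ a + b := fun h => ha (by linear_combination -h)
  have n24 : b ≠ -a := fun h => hc (by linear_combination h)
  have n26 : b ≠ -(a + b) := fun h => h3 (by linear_combination h)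
  have n34 : a + b ≠ -a := fun h => h2 (by linear_combination h)
  have n35 : a + b ≠ -b := fun h => h3 (by linear_combination h)
  have n45 : -a ≠ -b := fun h => h1 (neg_injective h)
  have n46 : -a ≠ -(a + b) := fun h => n13 (neg_injective h)
  have n56 : -b ≠ -(a + b) := fun h => n23 (neg_injective h)
  rw [Finset.card_insert_of_notMem, Finset.card_insert_of_notMem, Finset.card_insert_of_notMem,
    Finset.card_insert_of_notMem, Finset.card_insert_of_notMem, Finset.card_singleton]
  · simpa only [Finset.mem_singleton] using n56
  · simp only [Finset.mem_insert, Finset.mem_singleton, not_or]; exact ⟨n45, n46⟩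
  · simp only [Finset.mem_insert, Finset.mem_singleton, not_or]; exact ⟨n34, n35, dbl hc⟩
  · simp only [Finset.mem_insert, Finset.mem_singleton, not_or]; exact ⟨n23, n24, dbl hb, n26⟩
  · simp only [Finset.mem_insert, Finset.mem_singleton, not_or]
    exact ⟨h1, n13, dbl ha, n15, n16⟩

/-! ### Upper bound. -/

theorem card_filter_pow_eq_le {p : ℕ} [Fact p.Prime] {n : ℕ} (hn : 0 < n) (v : ZMod p) :
    ((Finset.univ : Finset (ZMod p)).filter (fun d => d ^ n = v)).card ≤ n := by
  refine le_trans (Finset.card_le_card ?_)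
    ((Multiset.toFinset_card_le _).trans (Polynomial.card_nthRoots n v))
  intro d hd
  rw [Multiset.mem_toFinset, Polynomial.mem_nthRoots hn]
  exact (Finset.mem_filter.1 hd).2

theorem IsConflictAvoidingCode.card_biUnion {n w : ℕ} {C D : Finset (Finset (ZMod n))}
    (hC : IsConflictAvoidingCode n w C) (hD : D ⊆ C) :
    (D.biUnion differenceSet).card = ∑ x ∈ D, (differenceSet x).card :=
  Finset.card_biUnion fun x hx y hy hxy => hC.2 x (hD hx) y (hD hy) hxy

theorem zero_notMem_differenceSet {n : ℕ} (x : Finset (ZMod n)) :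
    (0 : ZMod n) ∉ differenceSet x := by
  rw [mem_differenceSet]
  rintro ⟨a, -, b, -, hab, h⟩
  exact hab (sub_eq_zero.1 h)

/-- The upper bound on the size of a weight-three code: words with six differences are bounded by
the number of nonzero residues, and each coset of the `2m`-th roots of unity, `m = 2k + 1`, contains
the differences of at most `k` words that are arithmetic progressions. -/
theorem IsConflictAvoidingCode.card_le {p : ℕ} [Fact p.Prime] {k l : ℕ} (hp3 : 3 < p)
    (hl : 0 < l) (hp : p = 2 * (2 * k + 1) * l + 1)
    (h2 : (2 : ZMod p) ^ (2 * (2 * k + 1)) = 1)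
    {C : Finset (Finset (ZMod p))} (hC : IsConflictAvoidingCode p 3 C) :
    C.card ≤ l * k + l / 3 := by
  classical
  set m := 2 * k + 1 with hm
  set C₁ := C.filter (fun x => (differenceSet x).card < 6) with hC₁
  set C₂ := C.filter (fun x => ¬ (differenceSet x).card < 6) with hC₂
  have hsub : C₁ ⊆ C := Finset.filter_subset _ _
  have hcard : C₁.card + C₂.card = C.card :=
    Finset.card_filter_add_card_filter_not (fun x => (differenceSet x).card < 6)
  have hex : ∀ x ∈ C₁, ∃ e : ZMod p, e ≠ 0 ∧ differenceSet x = {e, -e, 2 * e, -(2 * e)} := by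
    intro x hx
    rw [hC₁, Finset.mem_filter] at hx
    exact (six_le_card_differenceSet_or hp3 (hC.1 x hx.1)).resolve_left (by omega)
  choose! e he0 he using hex
  have h4 : ∀ x ∈ C₁, (differenceSet x).card = 4 := fun x hx => by
    rw [he x hx, card_neg_two_mul hp3 (he0 x hx)]
  have htotal : 4 * C₁.card + 6 * C₂.card ≤ p - 1 := by
    have h1 : ∑ x ∈ C₁, (differenceSet x).card = C₁.card * 4 :=
      Finset.sum_const_nat h4
    have h2 : C₂.card • 6 ≤ ∑ x ∈ C₂, (differenceSet x).card :=
      Finset.card_nsmul_le_sum _ _ _ fun x hx => by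
        rw [hC₂, Finset.mem_filter] at hx; omega
    have h3 : ∑ x ∈ C, (differenceSet x).card ≤ p - 1 := by
      rw [← hC.card_biUnion subset_rfl]
      refine (Finset.card_le_card (t := Finset.univ.erase (0 : ZMod p)) ?_).trans ?_
      · intro d hd
        rw [Finset.mem_biUnion] at hd
        obtain ⟨x, -, hx⟩ := hd
        refine Finset.mem_erase.2 ⟨?_, Finset.mem_univ _⟩
        rintro rfl
        exact zero_notMem_differenceSet x hx
      · rw [Finset.card_erase_of_mem (Finset.mem_univ _), Finset.card_univ, ZMod.card]
    have h4' := Finset.sum_filter_add_sum_filter_not C (fun x => (differenceSet x).card < 6)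
      (fun x => (differenceSet x).card)
    rw [smul_eq_mul] at h2
    change ∑ x ∈ C₁, _ + ∑ x ∈ C₂, _ = _ at h4'
    omega
  -- The power `e ^ (2m)`, an `l`-th root of unity, labels the coset of `e`. In one fibre `4|F| ≤ 2m
  -- = 4k + 2`, hence `|F| ≤ k`.
  have hC₁card : C₁.card ≤ k * l := by
    refine le_trans (Finset.card_le_mul_card_image_of_maps_to (f := fun x => e x ^ (2 * m))
      (t := Finset.univ.filter (fun v : ZMod p => v ^ l = 1)) ?_ k ?_)
      (Nat.mul_le_mul_left k (card_filter_pow_eq_le hl 1))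
    · intro x hx
      rw [Finset.mem_filter]
      refine ⟨Finset.mem_univ _, ?_⟩
      rw [← pow_mul, show 2 * m * l = p - 1 by omega]
      exact ZMod.pow_card_sub_one_eq_one (he0 x hx)
    · intro v _
      set F := C₁.filter (fun x => e x ^ (2 * m) = v) with hF
      have hFC : F ⊆ C := (Finset.filter_subset _ _).trans hsub
      have h1 : ∑ x ∈ F, (differenceSet x).card = F.card * 4 :=
        Finset.sum_const_nat fun x hx => h4 x (Finset.filter_subset _ _ hx)
      have h3 : (F.biUnion differenceSet).card ≤ 2 * m := by
        refine le_trans (Finset.card_le_card ?_) (card_filter_pow_eq_le (by omega) v)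
        intro d hd
        rw [Finset.mem_biUnion] at hd
        obtain ⟨x, hx, hd⟩ := hd
        rw [hF, Finset.mem_filter] at hx
        rw [he x hx.1] at hd
        refine Finset.mem_filter.2 ⟨Finset.mem_univ _, ?_⟩
        rw [← hx.2]
        have hev : Even (2 * m) := even_two_mul m
        simp only [Finset.mem_insert, Finset.mem_singleton] at hd
        rcases hd with rfl | rfl | rfl | rfl
        · rfl
        · exact hev.neg_pow _
        · rw [mul_pow, h2, one_mul]
        · rw [hev.neg_pow, mul_pow, h2, one_mul]
      rw [hC.card_biUnion hFC, h1] at h3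
      omega
  have hexp : 2 * m * l = 4 * (k * l) + 2 * l := by rw [hm]; ring
  rw [mul_comm l k]
  -- Adding `2|C₁| ≤ 2kl` to `htotal` gives `6|C| ≤ 6kl + 2l`.
  omega

/-! ### Construction of an optimal code. -/

theorem exists_isConflictAvoidingCode_of_family {n w : ℕ} {ι : Type*} [Fintype ι]
    (W : ι → Finset (ZMod n)) (hcard : ∀ s, (W s).card = w)
    (hne : ∀ s, (differenceSet (W s)).Nonempty)
    (hdisj : ∀ s t, ∀ d ∈ differenceSet (W s), d ∈ differenceSet (W t) → s = t) :
    ∃ C, IsConflictAvoidingCode n w C ∧ C.card = Fintype.card ι := by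
  classical
  refine ⟨Finset.univ.image W, ⟨?_, ?_⟩, ?_⟩
  · intro x hx
    obtain ⟨s, -, rfl⟩ := Finset.mem_image.1 hx
    exact hcard s
  · intro x hx y hy hxy
    obtain ⟨s, -, rfl⟩ := Finset.mem_image.1 hx
    obtain ⟨t, -, rfl⟩ := Finset.mem_image.1 hy
    refine Finset.disjoint_left.2 fun d hs ht => hxy ?_
    rw [hdisj s t d hs ht]
  · rw [Finset.card_image_of_injective, Finset.card_univ]
    intro s t hst
    obtain ⟨d, hd⟩ := hne s
    exact hdisj s t d hd (hst ▸ hd)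

/-- A code attaining the upper bound: progressions `{0, a, 2a}` with `a = 2 ^ (2r + 1) e i`, where
`e i` represents the `i`-th coset of the `2m`-th roots of unity, together with multiples of
`{0, x, x ^ 2}` whose differences are exactly the remaining `± e i`. -/
theorem exists_isConflictAvoidingCode_card {p : ℕ} [Fact p.Prime] {k l : ℕ} (hl : l.Prime)
    (hp : p = 2 * (2 * k + 1) * l + 1)
    (h2 : (2 : ZMod p) ^ (2 * (2 * k + 1)) = 1)
    (h2' : ∀ n : ℕ, (2 : ZMod p) ^ (2 * n) = 1 → 2 * k + 1 ∣ n)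
    {x z : ZMod p} (hxz : x + z = 1) (hmul : (x * z) ^ (2 * (2 * k + 1)) = 1)
    (hx : x ^ (2 * (2 * k + 1)) ≠ 1) :
    ∃ C, IsConflictAvoidingCode p 3 C ∧ C.card = l * k + l / 3 := by
  set m := 2 * k + 1 with hm
  have hm0 : 2 * m ≠ 0 := by omega
  have h20 : (2 : ZMod p) ≠ 0 := by
    intro h; rw [h, zero_pow hm0] at h2; exact zero_ne_one h2
  have hxz0 : x * z ≠ 0 := by
    intro h; rw [h, zero_pow hm0] at hmul; exact zero_ne_one hmul
  have hx0 : x ≠ 0 := left_ne_zero_of_mul hxz0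
  have hord : orderOf (x ^ (2 * m)) = l := by
    have := Fact.mk hl
    refine orderOf_eq_prime ?_ hx
    rw [← pow_mul, show 2 * m * l = p - 1 by omega]
    exact ZMod.pow_card_sub_one_eq_one hx0
  -- The factor `xz` keeps the coset of `x ^ i` and makes `e (3j)` equal to `x ^ (3j+1) - x ^
  -- (3j+2)`, the third difference of a word.
  set e : ℕ → ZMod p := fun i => if 3 ∣ i then x * z * x ^ i else x ^ i with he
  have he0 (i) : e i ≠ 0 := by
    simp only [he]; split_ifs
    · exact mul_ne_zero hxz0 (pow_ne_zero _ hx0)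
    · exact pow_ne_zero _ hx0
  have hepow (i) : e i ^ (2 * m) = (x ^ (2 * m)) ^ i := by
    simp only [he]; split_ifs
    · rw [mul_pow, hmul, one_mul, ← pow_mul, ← pow_mul, mul_comm]
    · rw [← pow_mul, ← pow_mul, mul_comm]
  set E : ℕ → ℕ → ZMod p := fun i r => 2 ^ r * e i with hE
  have hE0 (i r) : E i r ≠ 0 := mul_ne_zero (pow_ne_zero _ h20) (he0 i)
  have hEpow (i r) : E i r ^ (2 * m) = (x ^ (2 * m)) ^ i := by
    simp only [hE]
    rw [mul_pow, hepow, ← pow_mul, mul_comm r, pow_mul, h2, one_pow, one_mul]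
  have hEsucc (i r) : E i (r + 1) = 2 * E i r := by simp only [hE]; ring
  -- Squares are compared because differences are known only up to sign.
  have two_pow_inj {r r' : ℕ} (hrr : r ≤ r') (hr' : r' < m)
      (h : ((2 : ZMod p) ^ r) ^ 2 = (2 ^ r') ^ 2) : r = r' := by
    obtain ⟨t, rfl⟩ := Nat.exists_eq_add_of_le hrr
    have h1 : (2 : ZMod p) ^ (2 * t) = 1 := by
      apply mul_left_cancel₀ (pow_ne_zero 2 (pow_ne_zero r h20))
      calc ((2 : ZMod p) ^ r) ^ 2 * 2 ^ (2 * t) = (2 ^ (r + t)) ^ 2 := by ring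
        _ = (2 ^ r) ^ 2 * 1 := by rw [h, mul_one]
    have := Nat.eq_zero_of_dvd_of_lt (h2' t h1) (by omega)
    omega
  have hinj {i i' r r' : ℕ} (hi : i < l) (hi' : i' < l) (hr : r < m) (hr' : r' < m) {d : ZMod p}
      (h : d = E i r ∨ d = -E i r) (h' : d = E i' r' ∨ d = -E i' r') : i = i' ∧ r = r' := by
    have hsq : E i r ^ 2 = E i' r' ^ 2 := by
      rcases h with rfl | rfl <;> rcases h' with h' | h'
      · rw [h']
      · rw [h', neg_sq]
      · rw [← h', neg_sq]
      · rw [neg_injective h']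
    have hii : i = i' := by
      have h1 : (x ^ (2 * m)) ^ i = (x ^ (2 * m)) ^ i' := by
        rw [← hEpow i r, ← hEpow i' r', pow_mul, hsq, ← pow_mul]
      exact pow_injOn_Iio_orderOf (by simpa [hord] using hi) (by simpa [hord] using hi') h1
    subst hii
    refine ⟨rfl, ?_⟩
    simp only [hE, mul_pow] at hsq
    have hsq' := mul_right_cancel₀ (pow_ne_zero 2 (he0 i)) hsq
    rcases le_total r r' with hrr | hrr
    · exact two_pow_inj hrr hr' hsq'
    · exact (two_pow_inj hrr hr hsq'.symm).symm
  -- The progressions use the exponents `r = 1, …, 2k = m - 1`; `r = 0` is reserved for the other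
  -- words.
  set W : Fin l × Fin k ⊕ Fin (l / 3) → Finset (ZMod p) := Sum.elim
    (fun q => {0, E q.1 (2 * q.2 + 1), E q.1 (2 * q.2 + 2)})
    (fun j => {0, x ^ (3 * j.1 + 1), x ^ (3 * j.1 + 2)}) with hW
  have triple (s) : ∃ a b : ZMod p, W s = {0, a, b} ∧ a ≠ 0 ∧ b ≠ 0 ∧ a ≠ b := by
    rcases s with q | j
    · refine ⟨_, _, rfl, hE0 _ _, hE0 _ _, fun h => hE0 q.1 (2 * q.2 + 1) ?_⟩
      rw [hEsucc _ (2 * q.2 + 1)] at h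
      linear_combination -h
    · refine ⟨_, _, rfl, pow_ne_zero _ hx0, pow_ne_zero _ hx0, fun h => hx ?_⟩
      have : x = 1 := by
        apply mul_left_cancel₀ (pow_ne_zero (3 * j.1 + 1) hx0)
        rw [← pow_succ, mul_one, h]
      rw [this, one_pow]
  -- Each difference is `±E i r`; by `hinj` the pair `(i, r)` is unique, and it identifies the word.
  have labels (s) (d) (hd : d ∈ differenceSet (W s)) : ∃ i r : ℕ, i < l ∧ r < m ∧
      (d = E i r ∨ d = -E i r) ∧ Sum.elim
        (fun q : Fin l × Fin k => i = q.1 ∧ (r = 2 * q.2 + 1 ∨ r = 2 * q.2 + 2))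
        (fun j : Fin (l / 3) => r = 0 ∧ i / 3 = j) s := by
    obtain ⟨a, b, hab, ha, hb, hne⟩ := triple s
    rcases s with q | j
    · have hq := q.1.2
      have hq2 := q.2.2
      have hdbl := hEsucc q.1 (2 * q.2 + 1)
      simp only [hW, Sum.elim_inl] at hd
      rw [differenceSet_triple (hE0 _ _).symm (hE0 _ _).symm (by
        intro h; rw [hdbl] at h; exact hE0 q.1 (2 * q.2 + 1) (by linear_combination -h))] at hd
      simp only [Finset.mem_insert, Finset.mem_singleton] at hd
      simp only [Sum.elim_inl]
      rcases hd with h | h | h | h | h | h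
      · exact ⟨q.1, 2 * q.2 + 1, hq, by omega, Or.inr (by rw [h]; ring), rfl, Or.inl rfl⟩
      · exact ⟨q.1, 2 * q.2 + 1, hq, by omega, Or.inr (by rw [h, hdbl]; ring), rfl, Or.inl rfl⟩
      · exact ⟨q.1, 2 * q.2 + 2, hq, by omega, Or.inr (by rw [h]; ring), rfl, Or.inr rfl⟩
      · exact ⟨q.1, 2 * q.2 + 1, hq, by omega, Or.inl (by rw [h]; ring), rfl, Or.inl rfl⟩
      · exact ⟨q.1, 2 * q.2 + 1, hq, by omega, Or.inl (by rw [h, hdbl]; ring), rfl, Or.inl rfl⟩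
      · exact ⟨q.1, 2 * q.2 + 2, hq, by omega, Or.inl (by rw [h]; ring), rfl, Or.inr rfl⟩
    · have hj := j.2
      have e0 : E (3 * j) 0 = x ^ (3 * j.1 + 1) - x ^ (3 * j.1 + 2) := by
        simp only [hE, he, dvd_mul_right, if_true]
        rw [show z = 1 - x by linear_combination hxz]; ring
      have e1 : E (3 * j + 1) 0 = x ^ (3 * j.1 + 1) := by
        simp only [hE, he]; rw [if_neg (by omega), pow_zero, one_mul]
      have e2 : E (3 * j + 2) 0 = x ^ (3 * j.1 + 2) := by
        simp only [hE, he]; rw [if_neg (by omega), pow_zero, one_mul]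
      have hsub : x ^ (3 * j.1 + 1) ≠ x ^ (3 * j.1 + 2) := by
        rw [← sub_ne_zero, ← e0]; exact hE0 _ _
      simp only [hW, Sum.elim_inr] at hd
      rw [differenceSet_triple (pow_ne_zero _ hx0).symm (pow_ne_zero _ hx0).symm hsub] at hd
      simp only [Finset.mem_insert, Finset.mem_singleton] at hd
      rw [← e0, ← e1, ← e2] at hd
      simp only [Sum.elim_inr]
      have hm' : 0 < m := by omega
      rcases hd with h | h | h | h | h | h
      · exact ⟨3 * j + 1, 0, by omega, hm', Or.inr (by rw [h]; ring), rfl, by omega⟩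
      · exact ⟨3 * j, 0, by omega, hm', Or.inl h, rfl, by omega⟩
      · exact ⟨3 * j + 2, 0, by omega, hm', Or.inr (by rw [h]; ring), rfl, by omega⟩
      · exact ⟨3 * j + 1, 0, by omega, hm', Or.inl (by rw [h]; ring), rfl, by omega⟩
      · exact ⟨3 * j, 0, by omega, hm', Or.inr h, rfl, by omega⟩
      · exact ⟨3 * j + 2, 0, by omega, hm', Or.inl (by rw [h]; ring), rfl, by omega⟩
  have hcardι : Fintype.card (Fin l × Fin k ⊕ Fin (l / 3)) = l * k + l / 3 := by simp
  rw [← hcardι]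
  refine exists_isConflictAvoidingCode_of_family W (fun s => ?_) (fun s => ?_) ?_
  · obtain ⟨a, b, hab, ha, hb, hne⟩ := triple s
    rw [hab]; exact Finset.card_eq_three.2 ⟨0, a, b, ha.symm, hb.symm, hne, rfl⟩
  · obtain ⟨a, b, hab, ha, hb, hne⟩ := triple s
    rw [hab]
    exact ⟨a, mem_differenceSet.2 ⟨a, by simp, 0, by simp, ha, sub_zero a⟩⟩
  · intro s t d hs ht
    obtain ⟨i, r, hi, hr, hd, hs⟩ := labels s d hs
    obtain ⟨i', r', hi', hr', hd', ht⟩ := labels t d ht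
    obtain ⟨rfl, rfl⟩ := hinj hi hi' hr hr' hd hd'
    rcases s with ⟨a, b⟩ | j <;> rcases t with ⟨a', b'⟩ | j' <;>
      simp only [Sum.elim_inl, Sum.elim_inr] at hs ht
    · rw [Sum.inl.injEq, Prod.mk.injEq, Fin.ext_iff, Fin.ext_iff]; omega
    · omega
    · omega
    · rw [Sum.inr.injEq, Fin.ext_iff]; omega

/-! ### Conclusion. -/

theorem theoremB (p : ℕ) (hp : p.Prime) (hp_odd : Odd p)
    (h_order : ¬ 4 ∣ orderOf (2 : ZMod p))
    (l : ℕ) (hl : l = (negOneTwoSubgroup p).index) (hl_prime : l.Prime) (hl_odd : Odd l) :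
    (∃ C : Finset (Finset (ZMod p)), IsOptimalConflictAvoidingCode p 3 C) ∧
      ∀ C : Finset (Finset (ZMod p)), IsOptimalConflictAvoidingCode p 3 C →
        (C.card : ℚ) = ((p : ℚ) - 1 - 2 * (l : ℚ)) / 4 + (⌊(l : ℚ) / 3⌋ : ℚ) := by
  have := Fact.mk hp
  obtain ⟨m, hm, hpm, h2, h2'⟩ := exists_odd_half_card_negOneTwoSubgroup hp_odd h_order
  rw [← hl] at hpm
  obtain ⟨x, z, hxz, hmul, hx⟩ := exists_add_eq_one_mul_pow_eq_one hm hl_odd hl_prime.one_lt hpm h2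
  obtain ⟨k, rfl⟩ := hm
  have hp3 : 3 < p := by
    have := hl_prime.two_le
    have : 2 * l ≤ 2 * (2 * k + 1) * l := Nat.mul_le_mul_right l (by omega)
    omega
  obtain ⟨C₀, hC₀, hcard⟩ := exists_isConflictAvoidingCode_card hl_prime hpm h2 h2' hxz hmul hx
  have upper {D} (hD : IsConflictAvoidingCode p 3 D) : D.card ≤ l * k + l / 3 :=
    hD.card_le hp3 hl_prime.pos hpm h2
  refine ⟨⟨C₀, hC₀, fun D hD => hcard ▸ upper hD⟩, fun C hC => ?_⟩
  have hCcard : C.card = l * k + l / 3 :=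
    le_antisymm (upper hC.1) (hcard ▸ hC.2 C₀ hC₀)
  have hfloor : ⌊(l : ℚ) / 3⌋ = ((l / 3 : ℕ) : ℤ) := by
    exact_mod_cast Rat.floor_natCast_div_natCast l 3
  rw [hCcard, hfloor, hpm, Int.cast_natCast]
  push_cast
  ring
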